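/- Let $J_1,\dots,J_N:\mathbb{R}^M\to\mathbb{R}$ be twice differentiable. Suppose that each $J_k$ is strongly convex ($\nabla^2J_k(w)\ge\nu_kI$ for all $w$, for some $\nu_k>0$), that all the $J_k$ have the same global minimizer $w^o$, and that $J^{\rm glob}=\sum_kJ_k$ satisfies $\nu_dI\le\nabla^2J^{\rm glob}(w)\le\delta_dI$ for all $w$, for some $0<\nu_d\le\delta_d$. Let $\beta_k^2,\sigma_{s,k}^2\ge0$ $(k=1,\dots,N)$ be constants. Consider $N$ agents that run asynchronous ATC diffusion: for $i\ge0$ and $k=1,\dots,N$, $$\boldsymbol\psi_{k,i}=\boldsymbol w_{k,i-1}-\boldsymbol\mu_k(i)\,\widehat{\nabla J}_k(\boldsymbol w_{k,i-1};\boldsymbol x_{k,i}),\qquad \boldsymbol w_{k,i}=\sum_{\ell=1}^N\boldsymbol a_{\ell k}(i)\,\boldsymbol\psi_{\ell,i},$$ where $\boldsymbol x_{k,i}$ is the (random) data of agent $k$ at time $i$, $\widehat{\nabla J}_k$ is a jointly measurable function of the point and the data, and the initial iterates $\boldsymbol w_{k,-1}$ are random with $\mathbb{E}\|\boldsymbol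 w_{k,-1}\|^2<\infty$. Assume: 1. The step-sizes $\boldsymbol\mu_k(i)$ are square-integrable random variables whose mean $\bar\mu_k>0$ and variance $\sigma_{\mu,k}^2$ do not depend on $i$. The random matrices $\boldsymbol A_i=[\boldsymbol a_{\ell k}(i)]$ are left-stochastic: $\boldsymbol a_{\ell k}(i)\ge0$ and $\sum_\ell\boldsymbol a_{\ell k}(i)=1$ almost surely. 2. The step-size vectors $(\boldsymbol\mu_k(i))_{k}$, $i\ge0$, the matrices $\boldsymbol A_i$, $i\ge0$, and the collection of all the other random variables of the algorithm (initial iterates and data of all times and agents) are mutually independent. (Step-sizes of different agents at the same time may be dependent, and so may different entries of one matrix $\boldsymbol A_i$.) 3. Let $\mathcal F_{i-1}$ be the $\sigma$-algebra generated by all iterates $\boldsymbol w_{\ell,j}$, $1\le\ell\le N$, $-1\le j\le i-1$, and let $\boldsymbol s_{k,i}=\widehat{\nabla J}_k(\boldsymbol w_{k,i-1};\boldsymbol x_{k,i})-\nabla J_k(\boldsymbol w_{k,i-1})$ be the gradient noise. It is square-integrable, and almost surely $\mathbb{E}[\boldsymbol s_{k,i}\mid\mathcal F_{i-1}]=0$,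 $\mathbb{E}[\boldsymbol s_{k,i}\boldsymbol s_{\ell,i}^{\mathsf T}\mid\mathcal F_{i-1}]=0$ for $k\ne\ell$, and $\mathbb{E}[\|\boldsymbol s_{k,i}\|^2\mid\mathcal F_{i-1}]\le\beta_k^2\|\widetilde{\boldsymbol w}_{k,i-1}\|^2+\sigma_{s,k}^2$, where $\widetilde{\boldsymbol w}_{k,i}=w^o-\boldsymbol w_{k,i}$. Let $\mu_{x,\max}=\max_{1\le k\le N}\left(\bar\mu_k+\sigma_{\mu,k}^2/\bar\mu_k\right)$. Then there are $\mu_o>0$ and $b\ge0$, which depend only on the costs $J_k$ (with $w^o$) and on the constants $\beta_k^2,\sigma_{s,k}^2$, such that whenever $\mu_{x,\max}<\mu_o$, $$\limsup_{i\to\infty}\mathbb{E}\|\widetilde{\boldsymbol w}_{k,i}\|^2\le b\,\mu_{x,\max}\qquad\text{for every agent }k;$$ that is, $\limsup_{i\to\infty}\mathbb{E}\|\widetilde{\boldsymbol w}_{k,i}\|^2=O(\mu_{x,\max})$. -/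

import Mathlib

open MeasureTheory ProbabilityTheory Filter

noncomputable section

/-- The Hessian of `J : ℝ^M → ℝ` at `w`: the derivative of the gradient map. -/
def hessian {M : ℕ} (J : EuclideanSpace ℝ (Fin M) → ℝ) (w : EuclideanSpace ℝ (Fin M)) :
    EuclideanSpace ℝ (Fin M) →L[ℝ] EuclideanSpace ℝ (Fin M) :=
  fderiv ℝ (gradient J) w

/-- `J` is twice (Fréchet) differentiable on `ℝ^M`. -/
def TwiceDifferentiable {M : ℕ} (J : EuclideanSpace ℝ (Fin M) → ℝ) : Prop :=
  Differentiable ℝ J ∧ Differentiable ℝ (gradient J)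

/-- `∇² J(w) ≥ ν I` for all `w`. -/
def HessianBoundedBelow {M : ℕ} (ν : ℝ) (J : EuclideanSpace ℝ (Fin M) → ℝ) : Prop :=
  ∀ w v : EuclideanSpace ℝ (Fin M), ν * ‖v‖ ^ 2 ≤ inner ℝ (hessian J w v) v

/-- `∇² J(w) ≤ δ I` for all `w`. -/
def HessianBoundedAbove {M : ℕ} (δ : ℝ) (J : EuclideanSpace ℝ (Fin M) → ℝ) : Prop :=
  ∀ w v : EuclideanSpace ℝ (Fin M), inner ℝ (hessian J w v) v ≤ δ * ‖v‖ ^ 2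

/-- Conditions on the costs: each `J k` is twice differentiable and strongly convex with
global minimizer `wo`, and the aggregate cost `∑ k, J k` satisfies `0 < ν I ≤ ∇² ≤ δ I`. -/
structure CostConditions {N M : ℕ} (J : Fin N → EuclideanSpace ℝ (Fin M) → ℝ)
    (wo : EuclideanSpace ℝ (Fin M)) : Prop where
  twiceDifferentiable : ∀ k, TwiceDifferentiable (J k)
  stronglyConvex : ∀ k, ∃ ν : ℝ, 0 < ν ∧ HessianBoundedBelow ν (J k)
  minimizer : ∀ k w, J k wo ≤ J k w
  aggregate : ∃ ν δ : ℝ, 0 < ν ∧ ν ≤ δ ∧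
    HessianBoundedBelow ν (fun w => ∑ k, J k w) ∧
    HessianBoundedAbove δ (fun w => ∑ k, J k w)

/-- The random variables that drive asynchronous ATC diffusion over `N` agents in `ℝ^M`.
The agents' approximate gradients are functions of streaming data: at time `i`, agent `k` uses
`gradHat k w (data i ω k)` in place of the gradient of its cost at `w`. -/
structure AsyncDiffusion (N M : ℕ) (Ω X : Type*) where
  /-- the initial iterates (those at time `-1`) -/
  init : Ω → Fin N → EuclideanSpace ℝ (Fin M)
  /-- `step i ω k` is the random step-size of agent `k` at time `i` -/
  step : ℕ → Ω → Fin N → ℝ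
  /-- `comb i ω` is the random combination matrix at time `i`; its entry `(ℓ, k)` is the weight
  that agent `k` gives to agent `ℓ` -/
  comb : ℕ → Ω → Matrix (Fin N) (Fin N) ℝ
  /-- `data i ω k` is the data sample of agent `k` at time `i` -/
  data : ℕ → Ω → Fin N → X
  /-- the approximate gradient of agent `k`, as a function of the point and the data sample -/
  gradHat : Fin N → EuclideanSpace ℝ (Fin M) → X → EuclideanSpace ℝ (Fin M)

namespace AsyncDiffusion

variable {N M : ℕ} {Ω X : Type*}

/-- The adaptation step at time `i`, started from the iterates `w`. -/
def adapt (net : AsyncDiffusion N M Ω X) (i : ℕ) (ω : Ω)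
    (w : Fin N → EuclideanSpace ℝ (Fin M)) (k : Fin N) : EuclideanSpace ℝ (Fin M) :=
  w k - net.step i ω k • net.gradHat k (w k) (net.data i ω k)

/-- The iterates of ATC diffusion. `net.iter i ω k` is the iterate of agent `k` before the update
of time `i` (after the update of time `i - 1`), so that index `0` is the initial condition.
The random neighbourhood of agent `k` at time `i` is the set of all `ℓ` whose weight is nonzero,
so the sum over the neighbourhood is the sum over all agents. -/
def iter (net : AsyncDiffusion N M Ω X) : ℕ → Ω → Fin N → EuclideanSpace ℝ (Fin M)
  | 0, ω => net.init ω
  | i + 1, ω => fun k => ∑ ℓ, net.comb i ω ℓ k • net.adapt i ω (net.iter i ω) ℓ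

/-- The σ-algebra generated by the iterates of all agents that are available when the update of
time `i` starts. -/
@[reducible] def past (net : AsyncDiffusion N M Ω X) (i : ℕ) : MeasurableSpace Ω :=
  ⨆ j ≤ i, MeasurableSpace.comap (net.iter j) inferInstance

/-- The gradient noise of agent `k` at time `i`, evaluated at its current iterate:
approximate gradient minus true gradient. -/
def noise (net : AsyncDiffusion N M Ω X) (J : Fin N → EuclideanSpace ℝ (Fin M) → ℝ)
    (i : ℕ) (k : Fin N) (ω : Ω) : EuclideanSpace ℝ (Fin M) :=
  net.gradHat k (net.iter i ω k) (net.data i ω k) - gradient (J k) (net.iter i ω k)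

variable [MeasurableSpace Ω]

/-- Mean of the step-size of agent `k` (the same at all times, see `Conditions`). -/
def stepMean (net : AsyncDiffusion N M Ω X) (P : Measure Ω) (k : Fin N) : ℝ :=
  ∫ ω, net.step 0 ω k ∂P

/-- Variance of the step-size of agent `k` (the same at all times, see `Conditions`). -/
def stepVar (net : AsyncDiffusion N M Ω X) (P : Measure Ω) (k : Fin N) : ℝ :=
  variance (fun ω => net.step 0 ω k) P

/-- `μ_{x,max}`, the maximum over the agents of the mean plus the variance divided by the mean
of their step-sizes. -/
def muxMax (net : AsyncDiffusion N M Ω X) (P : Measure Ω) : ℝ :=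
  ⨆ k, (net.stepMean P k + net.stepVar P k / net.stepMean P k)

/-- The mean-square error of agent `k` with respect to `wo`. -/
def meanSquareError (net : AsyncDiffusion N M Ω X) (P : Measure Ω)
    (wo : EuclideanSpace ℝ (Fin M)) (k : Fin N) (i : ℕ) : ENNReal :=
  ∫⁻ ω, ‖wo - net.iter i ω k‖ₑ ^ 2 ∂P

/-- The asynchronous network model. The step-size vectors of different times, the combination
matrices of different times, and the pair (initial iterates, data of all times and agents) are
mutually independent; step-sizes of different agents at one time, and different entries of one
combination matrix, may depend on each other. -/
structure Conditions [MeasurableSpace X] (net : AsyncDiffusion N M Ω X) (P : Measure Ω) : Prop where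
  measurable_init : Measurable net.init
  measurable_step : ∀ i, Measurable (net.step i)
  measurable_comb : ∀ i ℓ k, Measurable fun ω => net.comb i ω ℓ k
  measurable_data : ∀ i, Measurable (net.data i)
  measurable_gradHat : ∀ k, Measurable (Function.uncurry (net.gradHat k))
  /-- the initial iterates have finite second moments -/
  memLp_init : ∀ k, MemLp (fun ω => net.init ω k) 2 P
  /-- the step-sizes have finite second moments -/
  memLp_step : ∀ i k, MemLp (fun ω => net.step i ω k) 2 P
  mean_step : ∀ i k, ∫ ω, net.step i ω k ∂P = net.stepMean P k
  var_step : ∀ i k, variance (fun ω => net.step i ω k) P = net.stepVar P k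
  stepMean_pos : ∀ k, 0 < net.stepMean P k
  /-- the combination matrices are left-stochastic -/
  leftStochastic : ∀ i, ∀ᵐ ω ∂P,
    (∀ ℓ k, 0 ≤ net.comb i ω ℓ k) ∧ ∀ k, ∑ ℓ, net.comb i ω ℓ k = 1
  indep_step : iIndepFun net.step P
  indep_comb : iIndepFun (fun i ω ℓ k => net.comb i ω ℓ k) P
  indep_step_comb : IndepFun (fun ω i => net.step i ω) (fun ω i ℓ k => net.comb i ω ℓ k) P
  indep_other : IndepFun
    (fun ω => ((fun i => net.step i ω), (fun i ℓ k => net.comb i ω ℓ k)))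
    (fun ω => (net.init ω, fun i => net.data i ω)) P

/-- Conditions on the gradient noise: conditionally on the past iterates it has zero mean, is
uncorrelated across the agents, and has second moment at most
`β k ^ 2 * ‖wo - current iterate‖ ^ 2 + σs k ^ 2`. -/
structure GradientNoiseConditions (net : AsyncDiffusion N M Ω X) (P : Measure Ω)
    (J : Fin N → EuclideanSpace ℝ (Fin M) → ℝ) (wo : EuclideanSpace ℝ (Fin M))
    (β σs : Fin N → ℝ) : Prop where
  /-- the conditional first and second moments below are those of square-integrable variables -/
  memLp : ∀ i k, MemLp (net.noise J i k) 2 P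
  unbiased : ∀ i k, P[net.noise J i k | net.past i] =ᵐ[P] 0
  uncorrelated : ∀ i k ℓ, k ≠ ℓ → ∀ p q : Fin M,
    P[fun ω => net.noise J i k ω p * net.noise J i ℓ ω q | net.past i] =ᵐ[P] 0
  boundedVariance : ∀ i k,
    P[fun ω => ‖net.noise J i k ω‖ ^ 2 | net.past i] ≤ᵐ[P]
      fun ω => β k ^ 2 * ‖wo - net.iter i ω k‖ ^ 2 + σs k ^ 2

end AsyncDiffusion

end

-- The common minimizer makes every `gradient (J k)` vanish at `wo`, so each agent alone contracts
-- towards `wo`, up to noise, and averaging cannot hurt. Adaptation: write the new error as `D + μ •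
-- H`, with `D` the current error and `H` the true gradient plus noise. The step-size `μ` is
-- independent of `(D, H)`, so the mean square is `E‖D‖² + 2 E[μ] E⟪D, H⟫ + E[μ²] E‖H‖²`. The noise
-- is orthogonal to the past, so strong convexity bounds the cross term by `-2ν E[μ] E‖D‖²`. Since
-- `E[μ²] ≤ E[μ] * muxMax`, a small `muxMax` lets the quadratic term consume at most half of this
-- gain, leaving the factor `1 - ν E[μ]` and a noise term `E[μ] * muxMax * S`
-- (`Conditions.adapt_error_bound`). Combination: the weights are convex and independent of the
-- adapted iterates, so by Jensen any bound common to all agents survives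
-- (`Conditions.combine_error_bound`). The level `S / ν * muxMax` is the fixed point of every
-- agent's affine recursion, whatever its mean step-size. The excess over it decays geometrically
-- (`Conditions.error_bound`).

-- Gradient bounds from Hessian bounds

section Costs

variable {M : ℕ} {J : EuclideanSpace ℝ (Fin M) → ℝ}

theorem TwiceDifferentiable.hasFDerivAt_gradient (h : TwiceDifferentiable J)
    (w : EuclideanSpace ℝ (Fin M)) : HasFDerivAt (gradient J) (hessian J w) w :=
  (h.2 w).hasFDerivAt

/-- Mean value theorem for the gradient, tested against the direction of displacement. -/
theorem TwiceDifferentiable.exists_inner_gradient_sub (h : TwiceDifferentiable J)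
    (x v : EuclideanSpace ℝ (Fin M)) :
    ∃ z, inner ℝ (gradient J (x + v)) v - inner ℝ (gradient J x) v =
      inner ℝ (hessian J z v) v := by
  have hd : ∀ t : ℝ, HasDerivAt (fun t : ℝ => inner ℝ (gradient J (x + t • v)) v)
      (inner ℝ (hessian J (x + t • v) v) v) t := by
    intro t
    have h1 : HasDerivAt (fun t : ℝ => x + t • v) v t := by
      simpa using ((hasDerivAt_id t).smul_const v).const_add x
    have h2 := (h.hasFDerivAt_gradient (x + t • v)).comp_hasDerivAt t h1
    simpa using h2.inner ℝ (hasDerivAt_const t v)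
  -- The scalar mean value theorem on `[0, 1]` needs no continuity of the Hessian.
  obtain ⟨c, -, hc⟩ := exists_hasDerivAt_eq_slope _ _ zero_lt_one
    (fun t _ => (hd t).continuousAt.continuousWithinAt) (fun t _ => hd t)
  exact ⟨x + c • v, by simpa using hc.symm⟩

theorem inner_gradient_sub_ge (h : TwiceDifferentiable J) {ν : ℝ}
    (hν : HessianBoundedBelow ν J) (x v : EuclideanSpace ℝ (Fin M)) :
    ν * ‖v‖ ^ 2 ≤ inner ℝ (gradient J (x + v)) v - inner ℝ (gradient J x) v := by
  obtain ⟨z, hz⟩ := h.exists_inner_gradient_sub x v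
  exact hz ▸ hν z v

theorem inner_gradient_sub_le (h : TwiceDifferentiable J) {δ : ℝ}
    (hδ : HessianBoundedAbove δ J) (x v : EuclideanSpace ℝ (Fin M)) :
    inner ℝ (gradient J (x + v)) v - inner ℝ (gradient J x) v ≤ δ * ‖v‖ ^ 2 := by
  obtain ⟨z, hz⟩ := h.exists_inner_gradient_sub x v
  exact hz ▸ hδ z v

theorem gradient_eq_zero_of_forall_le {wo : EuclideanSpace ℝ (Fin M)} (hwo : ∀ w, J wo ≤ J w) :
    gradient J wo = 0 := by
  have : IsLocalMin J wo := Filter.Eventually.of_forall hwo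
  simp [gradient, this.fderiv_eq_zero]

/-- A crude descent lemma, by the mean value theorem. -/
theorem descent_of_hessianBoundedAbove (h : TwiceDifferentiable J) {δ : ℝ} (hδ0 : 0 ≤ δ)
    (hδ : HessianBoundedAbove δ J) (x v : EuclideanSpace ℝ (Fin M)) :
    J (x + v) ≤ J x + inner ℝ (gradient J x) v + δ * ‖v‖ ^ 2 := by
  have hd : ∀ t : ℝ, HasDerivAt (fun t : ℝ => J (x + t • v))
      (inner ℝ (gradient J (x + t • v)) v) t := by
    intro t
    have h1 : HasDerivAt (fun t : ℝ => x + t • v) v t := by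
      simpa using ((hasDerivAt_id t).smul_const v).const_add x
    have h2 := (h.1 (x + t • v)).hasGradientAt.hasFDerivAt.comp_hasDerivAt t h1
    exact h2
  obtain ⟨c, hc, hc'⟩ := exists_hasDerivAt_eq_slope _ _ zero_lt_one
    (fun t _ => (hd t).continuousAt.continuousWithinAt) (fun t _ => hd t)
  -- Both sides scale with `c > 0`; cancelling one factor and using `c < 1` gives the constant `δ`,
  -- in place of the sharp `δ / 2`.
  have h3 := inner_gradient_sub_le h hδ x (c • v)
  simp only [inner_smul_right, norm_smul, mul_pow, Real.norm_eq_abs, sq_abs] at h3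
  simp only [one_smul, zero_smul, add_zero, sub_zero, div_one] at hc'
  have h4 : inner ℝ (gradient J (x + c • v)) v - inner ℝ (gradient J x) v
      ≤ c * (δ * ‖v‖ ^ 2) := by
    refine le_of_mul_le_mul_left ?_ hc.1
    linarith
  have h5 : c * (δ * ‖v‖ ^ 2) ≤ δ * ‖v‖ ^ 2 :=
    mul_le_of_le_one_left (by positivity) hc.2.le
  linarith

/-- A function with a minimizer whose Hessian is bounded above has a gradient of linear growth. -/
theorem norm_gradient_sq_le (h : TwiceDifferentiable J) {δ : ℝ} (hδ0 : 0 < δ)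
    (hδ : HessianBoundedAbove δ J) {wo : EuclideanSpace ℝ (Fin M)} (hwo : ∀ w, J wo ≤ J w)
    (w : EuclideanSpace ℝ (Fin M)) :
    ‖gradient J w‖ ^ 2 ≤ (2 * δ) ^ 2 * ‖wo - w‖ ^ 2 := by
  have h1 := descent_of_hessianBoundedAbove h hδ0.le hδ wo (w - wo)
  -- This step minimizes the quadratic upper bound at `w`. It lowers `J` by at least `‖gradient J w‖
  -- ^ 2 / (4 * δ)`, which cannot exceed `J w - J wo ≤ δ * ‖wo - w‖ ^ 2`.
  have h2 := descent_of_hessianBoundedAbove h hδ0.le hδ w (-(2 * δ)⁻¹ • gradient J w)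
  have h3 := hwo (w + -(2 * δ)⁻¹ • gradient J w)
  rw [gradient_eq_zero_of_forall_le hwo, inner_zero_left, add_sub_cancel, norm_sub_rev] at h1
  rw [inner_smul_right, real_inner_self_eq_norm_sq, norm_smul, mul_pow, Real.norm_eq_abs,
    sq_abs] at h2
  have h4 : (4 * δ)⁻¹ * ‖gradient J w‖ ^ 2 ≤ δ * ‖wo - w‖ ^ 2 := by
    have : -(2 * δ)⁻¹ * ‖gradient J w‖ ^ 2 + δ * ((-(2 * δ)⁻¹) ^ 2 * ‖gradient J w‖ ^ 2)
        = -((4 * δ)⁻¹ * ‖gradient J w‖ ^ 2) := by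
      field_simp
      ring
    linarith
  rw [inv_mul_le_iff₀ (by positivity)] at h4
  linarith

/-- The other summands contribute nonnegative quadratic forms, so dropping them keeps the upper
bound. -/
theorem HessianBoundedAbove.of_sum {N : ℕ} {J : Fin N → EuclideanSpace ℝ (Fin M) → ℝ} {δ : ℝ}
    (hJ : ∀ k, TwiceDifferentiable (J k)) (hpos : ∀ k, HessianBoundedBelow 0 (J k))
    (hδ : HessianBoundedAbove δ (fun w => ∑ k, J k w)) (k : Fin N) :
    HessianBoundedAbove δ (J k) := by
  have hg : gradient (fun w => ∑ k, J k w) = fun w => ∑ k, gradient (J k) w := by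
    funext w
    simp only [gradient]
    rw [fderiv_fun_sum fun k _ => (hJ k).1 w, map_sum]
  intro w v
  refine le_trans ?_ (hδ w v)
  rw [hessian, hessian, hg, fderiv_fun_sum fun k _ => (hJ k).2 w, sum_apply,
    sum_inner]
  refine Finset.single_le_sum (f := fun k => inner ℝ (fderiv ℝ (gradient (J k)) w v) v)
    (fun j _ => ?_) (Finset.mem_univ k)
  simpa [hessian] using hpos j w v

/-- Everything the mean-square analysis needs from strong convexity, the common minimizer and the
aggregate bound: `ν` is the least convexity constant and `L` is `2 * δ`. -/
theorem CostConditions.exists_uniform_bounds {N : ℕ}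
    {J : Fin N → EuclideanSpace ℝ (Fin M) → ℝ} {wo : EuclideanSpace ℝ (Fin M)}
    (hJ : CostConditions J wo) :
    ∃ ν L : ℝ, 0 < ν ∧ 0 < L ∧ ∀ k w,
      inner ℝ (wo - w) (gradient (J k) w) ≤ -(ν * ‖wo - w‖ ^ 2) ∧
      ‖gradient (J k) w‖ ^ 2 ≤ L ^ 2 * ‖wo - w‖ ^ 2 := by
  choose ν hν0 hν using hJ.stronglyConvex
  obtain ⟨ν', δ, h1, h2, -, hδ⟩ := hJ.aggregate
  have hδ0 : 0 < δ := h1.trans_le h2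
  obtain ⟨m, hm0, hm⟩ : ∃ m, 0 < m ∧ ∀ k, m ≤ ν k := by
    rcases isEmpty_or_nonempty (Fin N) with h | h
    · exact ⟨1, one_pos, fun k => h.elim k⟩
    · obtain ⟨k₀, hk₀⟩ := Finite.exists_min ν
      exact ⟨ν k₀, hν0 k₀, hk₀⟩
  refine ⟨m, 2 * δ, hm0, by positivity, fun k w => ⟨?_, ?_⟩⟩
  · have h3 := inner_gradient_sub_ge (hJ.twiceDifferentiable k) (hν k) wo (w - wo)
    rw [gradient_eq_zero_of_forall_le (hJ.minimizer k), inner_zero_left, add_sub_cancel,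
      norm_sub_rev, real_inner_comm, ← neg_sub wo w, inner_neg_left] at h3
    have h4 := mul_le_mul_of_nonneg_right (hm k) (sq_nonneg ‖wo - w‖)
    linarith
  · refine norm_gradient_sq_le (hJ.twiceDifferentiable k) hδ0
      (HessianBoundedAbove.of_sum hJ.twiceDifferentiable (fun j x v => ?_) hδ k)
      (hJ.minimizer k) w
    have := hν j x v
    have := mul_nonneg (hν0 j).le (sq_nonneg ‖v‖)
    linarith

end Costs

-- Independence of a variable from its predecessors

section Independence

variable {Ω α β γ : Type*} [MeasurableSpace Ω] [MeasurableSpace α] [MeasurableSpace β]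
  [MeasurableSpace γ] {P : Measure Ω} [IsProbabilityMeasure P]

/-- The hypotheses make the law of the triple a product of three laws, which can be regrouped by
associativity. -/
theorem IndepFun.prodMk_right_of_prodMk_left {A : Ω → α} {B : Ω → β} {C : Ω → γ}
    (hA : Measurable A) (hB : Measurable B) (hC : Measurable C)
    (hAB : IndepFun A B P) (hABC : IndepFun (fun ω => (A ω, B ω)) C P) :
    IndepFun A (fun ω => (B ω, C ω)) P := by
  have hBC : IndepFun B C P := hABC.comp measurable_snd measurable_id
  rw [indepFun_iff_map_prod_eq_prod_map_map (by fun_prop) (by fun_prop)] at hAB hABC hBC ⊢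
  have := Measure.isProbabilityMeasure_map (μ := P) hA.aemeasurable
  have := Measure.isProbabilityMeasure_map (μ := P) hB.aemeasurable
  have := Measure.isProbabilityMeasure_map (μ := P) hC.aemeasurable
  rw [hBC, ← Measure.prodAssoc_prod, ← hAB, ← hABC, Measure.map_map (by fun_prop) (by fun_prop)]
  rfl

/-- A member of an independent sequence is independent of its predecessors, taken together with
any variables independent of the sequence. -/
theorem iIndepFun.indepFun_predecessors {X : ℕ → Ω → α} {Y : Ω → β} {Z : Ω → γ}
    (hX : ∀ i, Measurable (X i)) (hY : Measurable Y) (hZ : Measurable Z)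
    (hXi : iIndepFun X P) (hXY : IndepFun (fun ω i => X i ω) Y P)
    (hXYZ : IndepFun (fun ω => ((fun i => X i ω), Y ω)) Z P) (i : ℕ) :
    IndepFun (X i) (fun ω => ((((fun j : Finset.range i => X j ω), Y ω), Z ω))) P := by
  have h1 : IndepFun (X i) (fun ω (j : Finset.range i) => X j ω) P :=
    (hXi.indepFun_finset {i} (Finset.range i) (by simp) hX).comp
      (φ := fun f : ({i} : Finset ℕ) → α => f ⟨i, Finset.mem_singleton_self i⟩)
      (measurable_pi_apply (⟨i, Finset.mem_singleton_self i⟩ : ({i} : Finset ℕ))) measurable_id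
  have h2 : IndepFun (fun ω => (X i ω, fun j : Finset.range i => X j ω)) Y P :=
    hXY.comp (φ := fun f => (f i, fun j : Finset.range i => f j)) (by fun_prop) measurable_id
  have h3 := IndepFun.prodMk_right_of_prodMk_left (hX i) (by fun_prop) hY h1 h2
  refine IndepFun.prodMk_right_of_prodMk_left (hX i) (by fun_prop) hZ h3 ?_
  exact hXYZ.comp (φ := fun f => (f.1 i, ((fun j : Finset.range i => f.1 j), f.2)))
    (by fun_prop) measurable_id

end Independence

-- Measurability and independence of the iterates

namespace AsyncDiffusion

variable {N M : ℕ} {Ω X : Type*} {net : AsyncDiffusion N M Ω X}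

/-- The σ-algebra `m` is left free so that it can be one generated by selected driving variables;
measurability then yields independence. -/
theorem measurable_adapt_of_measurable [MeasurableSpace X] {m : MeasurableSpace Ω} {i : ℕ}
    (hg : ∀ k, Measurable (Function.uncurry (net.gradHat k)))
    (hstep : Measurable[m] (net.step i)) (hdata : Measurable[m] (net.data i))
    (hiter : Measurable[m] (net.iter i)) :
    Measurable[m] (fun ω => net.adapt i ω (net.iter i ω)) := by
  refine measurable_pi_lambda _ fun k => ?_
  have hw : Measurable[m] (fun ω => net.iter i ω k) := (measurable_pi_apply k).comp hiter
  have hs : Measurable[m] (fun ω => net.step i ω k) := (measurable_pi_apply k).comp hstep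
  have hd : Measurable[m] (fun ω => net.data i ω k) := (measurable_pi_apply k).comp hdata
  exact hw.sub (hs.smul ((hg k).comp (hw.prodMk hd)))

/-- The iterates are functions of the earlier step-sizes and combination matrices, the initial
iterates and the data. -/
theorem measurable_iter_of_measurable [MeasurableSpace X] {m : MeasurableSpace Ω} {i : ℕ}
    (hg : ∀ k, Measurable (Function.uncurry (net.gradHat k)))
    (hinit : Measurable[m] net.init) (hdata : ∀ j, Measurable[m] (net.data j))
    (hstep : ∀ j < i, Measurable[m] (net.step j))
    (hcomb : ∀ j < i, ∀ ℓ k, Measurable[m] fun ω => net.comb j ω ℓ k) :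
    Measurable[m] (net.iter i) := by
  induction i with
  | zero => exact hinit
  | succ i ih =>
    have h1 := measurable_adapt_of_measurable hg (hstep i i.lt_succ_self) (hdata i)
      (ih (fun j hj => hstep j (by omega)) fun j hj => hcomb j (by omega))
    refine measurable_pi_lambda _ fun k => ?_
    have h2 : ∀ ℓ, Measurable[m] fun ω => net.adapt i ω (net.iter i ω) ℓ := fun ℓ =>
      (measurable_pi_apply ℓ).comp h1
    exact Finset.measurable_sum _ fun ℓ _ => (hcomb i i.lt_succ_self ℓ k).smul (h2 ℓ)

theorem measurable_iter_past (i : ℕ) : Measurable[net.past i] (net.iter i) :=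
  Measurable.mono (comap_measurable _)
    (le_iSup₂_of_le (f := fun j (_ : j ≤ i) => MeasurableSpace.comap (net.iter j) inferInstance)
      i le_rfl le_rfl) le_rfl

variable [MeasurableSpace Ω] [MeasurableSpace X] {P : Measure Ω}

theorem Conditions.measurable_iter (h : net.Conditions P) (i : ℕ) : Measurable (net.iter i) :=
  measurable_iter_of_measurable h.measurable_gradHat h.measurable_init h.measurable_data
    (fun j _ => h.measurable_step j) fun j _ => h.measurable_comb j

theorem Conditions.past_le (h : net.Conditions P) (i : ℕ) : net.past i ≤ ‹MeasurableSpace Ω› :=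
  iSup₂_le fun j _ => (h.measurable_iter j).comap_le

variable [IsProbabilityMeasure P]

/-- The current iterate involves only step-sizes of times before `i`. Combination matrices of all
times may be adjoined, being independent of the step-sizes. -/
theorem Conditions.indepFun_step (h : net.Conditions P) (i : ℕ) :
    IndepFun (net.step i) (fun ω => (net.iter i ω, net.data i ω)) P := by
  have hc : Measurable fun ω (i : ℕ) (ℓ k : Fin N) => net.comb i ω ℓ k := by
    have := h.measurable_comb
    fun_prop
  have ho : Measurable fun ω => (net.init ω, fun i => net.data i ω) := by
    have := h.measurable_init
    have := h.measurable_data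
    fun_prop
  have h1 := iIndepFun.indepFun_predecessors h.measurable_step hc ho h.indep_step
    h.indep_step_comb h.indep_other i
  refine indep_of_indep_of_le_right h1 ?_
  rw [← measurable_iff_comap_le]
  set T := (fun ω => ((((fun j : Finset.range i => net.step j ω),
    fun i ℓ k => net.comb i ω ℓ k), (net.init ω, fun i => net.data i ω)))) with hT
  have hTm : Measurable[MeasurableSpace.comap T inferInstance] T := comap_measurable T
  have hd : ∀ j, Measurable[MeasurableSpace.comap T inferInstance] (net.data j) := fun j =>
    (((measurable_pi_apply j).comp measurable_snd).comp measurable_snd).comp hTm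
  refine Measurable.prodMk (measurable_iter_of_measurable h.measurable_gradHat
    ((measurable_fst.comp measurable_snd).comp hTm) hd (fun j hj => ?_) fun j _ ℓ k => ?_) (hd i)
  · exact (((measurable_pi_apply (⟨j, by simpa using hj⟩ : Finset.range i)).comp
      measurable_fst).comp measurable_fst).comp hTm
  · exact ((((measurable_pi_apply k).comp (measurable_pi_apply ℓ)).comp
      (measurable_pi_apply j)).comp (measurable_snd.comp measurable_fst)).comp hTm

/-- The same argument with the roles exchanged: the adapted iterates use the step-sizes up to and
including time `i`, but only matrices of earlier times. -/
theorem Conditions.indepFun_comb (h : net.Conditions P) (i : ℕ) :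
    IndepFun (fun ω ℓ k => net.comb i ω ℓ k) (fun ω => net.adapt i ω (net.iter i ω)) P := by
  have hs : Measurable fun ω i => net.step i ω := by
    have := h.measurable_step
    fun_prop
  have hc : ∀ i, Measurable fun ω (ℓ k : Fin N) => net.comb i ω ℓ k := by
    have := h.measurable_comb
    fun_prop
  have ho : Measurable fun ω => (net.init ω, fun i => net.data i ω) := by
    have := h.measurable_init
    have := h.measurable_data
    fun_prop
  have h1 := iIndepFun.indepFun_predecessors hc hs ho h.indep_comb h.indep_step_comb.symm
    (h.indep_other.comp measurable_swap measurable_id) i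
  refine indep_of_indep_of_le_right h1 ?_
  rw [← measurable_iff_comap_le]
  set T := (fun ω => ((((fun (j : Finset.range i) ℓ k => net.comb j ω ℓ k),
    fun i => net.step i ω), (net.init ω, fun i => net.data i ω)))) with hT
  have hTm : Measurable[MeasurableSpace.comap T inferInstance] T := comap_measurable T
  have hd : ∀ j, Measurable[MeasurableSpace.comap T inferInstance] (net.data j) := fun j =>
    (((measurable_pi_apply j).comp measurable_snd).comp measurable_snd).comp hTm
  have hst : ∀ j, Measurable[MeasurableSpace.comap T inferInstance] (net.step j) := fun j =>
    (((measurable_pi_apply j).comp measurable_snd).comp measurable_fst).comp hTm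
  refine measurable_adapt_of_measurable h.measurable_gradHat (hst i) (hd i)
    (measurable_iter_of_measurable h.measurable_gradHat
    ((measurable_fst.comp measurable_snd).comp hTm) hd (fun j _ => hst j) fun j hj ℓ k => ?_)
  exact ((((measurable_pi_apply k).comp (measurable_pi_apply ℓ)).comp
      (measurable_pi_apply (⟨j, by simpa using hj⟩ : Finset.range i))).comp
      (measurable_fst.comp measurable_fst)).comp hTm

end AsyncDiffusion

-- Second moments, orthogonality and convexity

section SecondMoments

variable {Ω E : Type*} [mΩ : MeasurableSpace Ω] {P : Measure Ω}
  [NormedAddCommGroup E] [InnerProductSpace ℝ E]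

theorem MemLp.integrable_inner_of_two {f g : Ω → E} (hf : MemLp f 2 P) (hg : MemLp g 2 P) :
    Integrable (fun ω => inner ℝ (f ω) (g ω)) P :=
  (hf.norm.integrable_mul hg.norm).mono (hf.1.inner hg.1) <| Eventually.of_forall fun ω => by
    simpa using norm_inner_le_norm (𝕜 := ℝ) (f ω) (g ω)

theorem integral_norm_add_sq {f g : Ω → E} (hf : MemLp f 2 P) (hg : MemLp g 2 P) :
    ∫ ω, ‖f ω + g ω‖ ^ 2 ∂P =
      ∫ ω, ‖f ω‖ ^ 2 ∂P + 2 * ∫ ω, inner ℝ (f ω) (g ω) ∂P + ∫ ω, ‖g ω‖ ^ 2 ∂P := by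
  have h1 := (MemLp.integrable_inner_of_two hf hg).const_mul 2
  have h2 := (memLp_two_iff_integrable_sq_norm hf.1).1 hf
  have h3 := (memLp_two_iff_integrable_sq_norm hg.1).1 hg
  have h12 : Integrable (fun ω => ‖f ω‖ ^ 2 + 2 * inner ℝ (f ω) (g ω)) P := h2.add h1
  simp only [norm_add_sq_real]
  rw [integral_add h12 h3, integral_add h2 h1, integral_const_mul]

variable [MeasurableSpace E] [BorelSpace E]

/-- Independence makes the product of the integrable variables `μ ^ 2` and `‖H‖ ^ 2` integrable, so
no fourth moments are needed. -/
theorem memLp_smul_of_indepFun {μ : Ω → ℝ} {H : Ω → E} (hμ : MemLp μ 2 P) (hH : MemLp H 2 P)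
    (hind : IndepFun μ H P) : MemLp (fun ω => μ ω • H ω) 2 P := by
  refine (memLp_two_iff_integrable_sq_norm (hμ.1.smul hH.1)).2 ?_
  have h1 := ((hind.comp (φ := fun x => x ^ 2) (ψ := fun x => ‖x‖ ^ 2) (by fun_prop)
    (by fun_prop)).integrable_mul hμ.integrable_sq
    ((memLp_two_iff_integrable_sq_norm hH.1).1 hH))
  refine h1.congr (Eventually.of_forall fun ω => ?_)
  simp [norm_smul, mul_pow]

/-- Second moment of a random step in an independent direction. -/
theorem integral_norm_add_smul_sq [SecondCountableTopology E] {μ : Ω → ℝ} {D H : Ω → E} (hμ : MemLp μ 2 P)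
    (hD : MemLp D 2 P) (hH : MemLp H 2 P) (hind : IndepFun μ (fun ω => (D ω, H ω)) P) :
    ∫ ω, ‖D ω + μ ω • H ω‖ ^ 2 ∂P =
      ∫ ω, ‖D ω‖ ^ 2 ∂P + 2 * ((∫ ω, μ ω ∂P) * ∫ ω, inner ℝ (D ω) (H ω) ∂P) +
        (∫ ω, μ ω ^ 2 ∂P) * ∫ ω, ‖H ω‖ ^ 2 ∂P := by
  have hindH : IndepFun μ H P := hind.comp measurable_id measurable_snd
  rw [integral_norm_add_sq hD (memLp_smul_of_indepFun hμ hH hindH)]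
  have h1 : IndepFun μ (fun ω => inner ℝ (D ω) (H ω)) P :=
    hind.comp (ψ := fun p : E × E => (inner ℝ p.1 p.2 : ℝ)) measurable_id (by fun_prop)
  have h2 : IndepFun (fun ω => μ ω ^ 2) (fun ω => ‖H ω‖ ^ 2) P :=
    hindH.comp (φ := fun x => x ^ 2) (ψ := fun x => ‖x‖ ^ 2) (by fun_prop) (by fun_prop)
  rw [← h1.integral_fun_mul_eq_mul_integral hμ.1 (hD.1.inner hH.1),
    ← h2.integral_fun_mul_eq_mul_integral (hμ.1.pow 2) (hH.1.norm.pow 2)]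
  simp only [inner_smul_right, norm_smul, mul_pow, Real.norm_eq_abs, sq_abs]

end SecondMoments

/-- A square-integrable variable with zero conditional mean is orthogonal to every
square-integrable variable of the past. -/
theorem integral_inner_eq_zero_of_condExp_eq_zero {Ω E : Type*} {m mΩ : MeasurableSpace Ω}
    {P : Measure Ω} [IsFiniteMeasure P] [NormedAddCommGroup E] [InnerProductSpace ℝ E]
    [CompleteSpace E] (hm : m ≤ mΩ) {f s : Ω → E} (hfm : StronglyMeasurable[m] f)
    (hf : MemLp f 2 P) (hs : MemLp s 2 P) (h0 : P[s | m] =ᵐ[P] 0) :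
    ∫ ω, inner ℝ (f ω) (s ω) ∂P = 0 := by
  have h1 := condExp_bilin_of_stronglyMeasurable_left (innerSL ℝ) hfm
    (MemLp.integrable_inner_of_two hf hs) (hs.integrable one_le_two)
  have h2 : P[fun ω => innerSL ℝ (f ω) (s ω) | m] =ᵐ[P] fun _ => 0 := by
    filter_upwards [h1, h0] with ω hω hω'
    rw [hω, hω']
    simp
  have h3 := integral_condExp hm (μ := P) (f := fun ω => innerSL ℝ (f ω) (s ω))
  rw [integral_congr_ae h2, integral_zero] at h3
  exact h3.symm

section WeightedMean

variable {ι E : Type*} [Fintype ι] [NormedAddCommGroup E] [NormedSpace ℝ E]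

theorem norm_sum_smul_sq_le {a : ι → ℝ} (ha : ∀ i, 0 ≤ a i) (hsum : ∑ i, a i = 1) (x : ι → E) :
    ‖∑ i, a i • x i‖ ^ 2 ≤ ∑ i, a i * ‖x i‖ ^ 2 := by
  have h : ConvexOn ℝ Set.univ fun x : E => ‖x‖ ^ 2 :=
    convexOn_univ_norm.pow (fun x _ => norm_nonneg x) 2
  simpa using h.map_sum_le (fun i _ => ha i) hsum fun i _ => Set.mem_univ (x i)

end WeightedMean

-- The mean-square error recursion

namespace AsyncDiffusion

variable {N M : ℕ} {Ω X : Type*} {net : AsyncDiffusion N M Ω X}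
  {J : Fin N → EuclideanSpace ℝ (Fin M) → ℝ} {wo : EuclideanSpace ℝ (Fin M)} {β σs : Fin N → ℝ}
  [MeasurableSpace Ω] {P : Measure Ω}

theorem meanSquareError_eq_ofReal {i : ℕ} {k : Fin N}
    (hmem : MemLp (fun ω => wo - net.iter i ω k) 2 P) :
    net.meanSquareError P wo k i = ENNReal.ofReal (∫ ω, ‖wo - net.iter i ω k‖ ^ 2 ∂P) := by
  rw [ofReal_integral_eq_lintegral_ofReal ((memLp_two_iff_integrable_sq_norm hmem.1).1 hmem)
    (Eventually.of_forall fun ω => by positivity), meanSquareError]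
  refine lintegral_congr fun ω => ?_
  rw [ENNReal.ofReal_pow (norm_nonneg _), ofReal_norm]

variable [MeasurableSpace X]

theorem Conditions.stepMean_le_muxMax (h : net.Conditions P) (k : Fin N) :
    net.stepMean P k ≤ net.muxMax P := by
  have h2 : net.stepMean P k + net.stepVar P k / net.stepMean P k ≤ net.muxMax P :=
    le_ciSup (f := fun k => net.stepMean P k + net.stepVar P k / net.stepMean P k)
      (Set.finite_range _).bddAbove k
  have : 0 ≤ net.stepVar P k / net.stepMean P k :=
    div_nonneg (variance_nonneg _ _) (h.stepMean_pos k).le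
  linarith

variable [IsProbabilityMeasure P]

/-- With mean `m` and variance `v`, the second moment is `v + m ^ 2 = m * (m + v / m)`; this is why
`muxMax` is the relevant step-size parameter. -/
theorem Conditions.integral_step_sq_le (h : net.Conditions P) (i : ℕ) (k : Fin N) :
    ∫ ω, net.step i ω k ^ 2 ∂P ≤ net.stepMean P k * net.muxMax P := by
  have h1 := variance_eq_sub (h.memLp_step i k)
  rw [h.var_step, h.mean_step] at h1
  have h2 : net.stepMean P k + net.stepVar P k / net.stepMean P k ≤ net.muxMax P :=
    le_ciSup (f := fun k => net.stepMean P k + net.stepVar P k / net.stepMean P k)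
      (Set.finite_range _).bddAbove k
  have h3 := h.stepMean_pos k
  refine le_trans (le_of_eq ?_) (mul_le_mul_of_nonneg_left h2 h3.le)
  have h4 : ∫ ω, net.step i ω k ^ 2 ∂P = net.stepVar P k + net.stepMean P k ^ 2 := by
    rw [h1]
    simp
  rw [h4]
  field_simp
  ring

theorem Conditions.memLp_error_zero (h : net.Conditions P) (k : Fin N) :
    MemLp (fun ω => wo - net.iter 0 ω k) 2 P :=
  (memLp_const wo).sub (h.memLp_init k)

theorem Conditions.adapt_error_bound (h : net.Conditions P)
    (hn : net.GradientNoiseConditions P J wo β σs) {ν L B S : ℝ}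
    (hJ : ∀ k, TwiceDifferentiable (J k))
    (hgrad : ∀ k w, inner ℝ (wo - w) (gradient (J k) w) ≤ -(ν * ‖wo - w‖ ^ 2) ∧
      ‖gradient (J k) w‖ ^ 2 ≤ L ^ 2 * ‖wo - w‖ ^ 2)
    (hβ : ∀ k, β k ^ 2 ≤ B) (hσ : ∀ k, σs k ^ 2 ≤ S)
    (hμ : net.muxMax P * (L ^ 2 + B) ≤ ν) (i : ℕ) (k : Fin N)
    (hmem : MemLp (fun ω => wo - net.iter i ω k) 2 P) :
    MemLp (fun ω => wo - net.adapt i ω (net.iter i ω) k) 2 P ∧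
    ∫ ω, ‖wo - net.adapt i ω (net.iter i ω) k‖ ^ 2 ∂P ≤
      (1 - ν * net.stepMean P k) * ∫ ω, ‖wo - net.iter i ω k‖ ^ 2 ∂P +
        net.stepMean P k * (net.muxMax P * S) := by
  set D : Ω → EuclideanSpace ℝ (Fin M) := fun ω => wo - net.iter i ω k with hD
  set G : Ω → EuclideanSpace ℝ (Fin M) := fun ω => gradient (J k) (net.iter i ω k) with hG
  set s := net.noise J i k with hs
  set H : Ω → EuclideanSpace ℝ (Fin M) := fun ω => G ω + s ω with hH
  have hHeq : ∀ ω, H ω = net.gradHat k (net.iter i ω k) (net.data i ω k) := fun ω => by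
    simp [hH, hG, hs, noise]
  have hadapt : (fun ω => wo - net.adapt i ω (net.iter i ω) k) =
      fun ω => D ω + net.step i ω k • H ω := by
    funext ω
    rw [hHeq]
    simp only [adapt, hD]
    abel
  have hiter : Measurable[net.past i] fun ω => net.iter i ω k :=
    (measurable_pi_apply k).comp (measurable_iter_past i)
  have hDm : StronglyMeasurable[net.past i] D := (hiter.const_sub wo).stronglyMeasurable
  have hGm : StronglyMeasurable[net.past i] G :=
    ((hJ k).2.continuous.measurable.comp hiter).stronglyMeasurable
  have hDsq := (memLp_two_iff_integrable_sq_norm hmem.1).1 hmem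
  have hGmem : MemLp G 2 P := by
    have haes := (hGm.mono (h.past_le i)).aestronglyMeasurable (μ := P)
    refine (memLp_two_iff_integrable_sq_norm haes).2 ((hDsq.const_mul (L ^ 2)).mono
      (haes.norm.pow 2) (Eventually.of_forall fun ω => ?_))
    rw [Real.norm_of_nonneg (by positivity), Real.norm_of_nonneg (by positivity)]
    exact (hgrad k _).2
  have hsmem : MemLp s 2 P := hn.memLp i k
  have hHmem : MemLp H 2 P := hGmem.add hsmem
  -- `D` and `H` are functions of the current iterates and data only.
  have hind : IndepFun (fun ω => net.step i ω k) (fun ω => (D ω, H ω)) P := by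
    have hg := h.measurable_gradHat k
    have hφ : Measurable fun f : Fin N → ℝ => f k := measurable_pi_apply k
    have hψ : Measurable fun p : (Fin N → EuclideanSpace ℝ (Fin M)) × (Fin N → X) =>
        (wo - p.1 k, Function.uncurry (net.gradHat k) (p.1 k, p.2 k)) := by fun_prop
    have := (h.indepFun_step i).comp hφ hψ
    refine this.congr (ae_eq_refl _) (Eventually.of_forall fun ω => ?_)
    simp [hHeq, hD]
  have hindH : IndepFun (fun ω => net.step i ω k) H P := hind.comp measurable_id measurable_snd
  have hstep := h.memLp_step i k
  simp only [funext_iff] at hadapt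
  simp only [hadapt]
  refine ⟨hmem.add (memLp_smul_of_indepFun hstep hHmem hindH), ?_⟩
  rw [integral_norm_add_smul_sq hstep hmem hHmem hind, h.mean_step]
  have hDs : ∫ ω, inner ℝ (D ω) (s ω) ∂P = 0 :=
    integral_inner_eq_zero_of_condExp_eq_zero (h.past_le i) hDm hmem hsmem (hn.unbiased i k)
  have hGs : ∫ ω, inner ℝ (G ω) (s ω) ∂P = 0 :=
    integral_inner_eq_zero_of_condExp_eq_zero (h.past_le i) hGm hGmem hsmem (hn.unbiased i k)
  have hDH : ∫ ω, inner ℝ (D ω) (H ω) ∂P ≤ -(ν * ∫ ω, ‖D ω‖ ^ 2 ∂P) := by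
    have h1 : ∫ ω, inner ℝ (D ω) (H ω) ∂P = ∫ ω, inner ℝ (D ω) (G ω) ∂P := by
      simp only [hH, inner_add_right]
      rw [integral_add (MemLp.integrable_inner_of_two hmem hGmem)
        (MemLp.integrable_inner_of_two hmem hsmem), hDs, add_zero]
    rw [h1, ← integral_const_mul, ← integral_neg]
    exact integral_mono (MemLp.integrable_inner_of_two hmem hGmem) (hDsq.const_mul ν).neg
      fun ω => (hgrad k _).1
  have hG2 : ∫ ω, ‖G ω‖ ^ 2 ∂P ≤ L ^ 2 * ∫ ω, ‖D ω‖ ^ 2 ∂P := by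
    rw [← integral_const_mul]
    exact integral_mono ((memLp_two_iff_integrable_sq_norm hGmem.1).1 hGmem)
      (hDsq.const_mul _) fun ω => (hgrad k _).2
  -- The conditional variance bound is integrated by the tower property.
  have hs2 : ∫ ω, ‖s ω‖ ^ 2 ∂P ≤ B * ∫ ω, ‖D ω‖ ^ 2 ∂P + S := by
    rw [← integral_condExp (h.past_le i)]
    have h1 : Integrable (fun ω => β k ^ 2 * ‖D ω‖ ^ 2 + σs k ^ 2) P :=
      (hDsq.const_mul _).add (integrable_const _)
    refine (integral_mono_ae integrable_condExp h1 (hn.boundedVariance i k)).trans ?_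
    rw [integral_add (hDsq.const_mul _) (integrable_const _), integral_const_mul]
    simp only [integral_const, probReal_univ, one_smul]
    have h2 : 0 ≤ ∫ ω, ‖D ω‖ ^ 2 ∂P := integral_nonneg fun ω => by positivity
    exact add_le_add (mul_le_mul_of_nonneg_right (hβ k) h2) (hσ k)
  have hH2 : ∫ ω, ‖H ω‖ ^ 2 ∂P ≤ (L ^ 2 + B) * ∫ ω, ‖D ω‖ ^ 2 ∂P + S := by
    rw [integral_norm_add_sq hGmem hsmem, hGs]
    linarith
  have hH0 : 0 ≤ ∫ ω, ‖H ω‖ ^ 2 ∂P := integral_nonneg fun ω => by positivity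
  have hD0 : 0 ≤ ∫ ω, ‖D ω‖ ^ 2 ∂P := integral_nonneg fun ω => by positivity
  have hm := h.stepMean_pos k
  have hx0 : 0 ≤ net.muxMax P := hm.le.trans (h.stepMean_le_muxMax k)
  have e1 := mul_le_mul_of_nonneg_left hDH hm.le
  have e2 := mul_le_mul_of_nonneg_right (h.integral_step_sq_le i k) hH0
  have e3 := mul_le_mul_of_nonneg_left hH2 (mul_nonneg hm.le hx0)
  -- By `hμ`, the quadratic term costs at most `ν * stepMean` out of the gain `2 * ν * stepMean`.
  have e4 := mul_le_mul_of_nonneg_left (mul_le_mul_of_nonneg_right hμ hD0) hm.le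
  linarith

/-- Jensen holds pointwise for the random weights. Independence then factors each expectation, and
the mean weights again sum to one; dependence among the entries of one matrix does not matter. -/
theorem Conditions.combine_error_bound (h : net.Conditions P) (i : ℕ)
    (hmem : ∀ ℓ, MemLp (fun ω => wo - net.adapt i ω (net.iter i ω) ℓ) 2 P) {C : ℝ}
    (hC : ∀ ℓ, ∫ ω, ‖wo - net.adapt i ω (net.iter i ω) ℓ‖ ^ 2 ∂P ≤ C) (k : Fin N) :
    MemLp (fun ω => wo - net.iter (i + 1) ω k) 2 P ∧
    ∫ ω, ‖wo - net.iter (i + 1) ω k‖ ^ 2 ∂P ≤ C := by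
  set Y : Fin N → Ω → ℝ := fun ℓ ω => ‖wo - net.adapt i ω (net.iter i ω) ℓ‖ ^ 2 with hY
  have hYint : ∀ ℓ, Integrable (Y ℓ) P := fun ℓ =>
    (memLp_two_iff_integrable_sq_norm (hmem ℓ).1).1 (hmem ℓ)
  have haint : ∀ ℓ, Integrable (fun ω => net.comb i ω ℓ k) P := fun ℓ => by
    refine Integrable.of_bound (h.measurable_comb i ℓ k).aestronglyMeasurable 1 ?_
    filter_upwards [h.leftStochastic i] with ω hω
    rw [Real.norm_of_nonneg (hω.1 ℓ k), ← hω.2 k]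
    exact Finset.single_le_sum (f := fun ℓ => net.comb i ω ℓ k) (fun j _ => hω.1 j k)
      (Finset.mem_univ ℓ)
  have hind : ∀ ℓ, IndepFun (fun ω => net.comb i ω ℓ k) (Y ℓ) P := fun ℓ =>
    (h.indepFun_comb i).comp (φ := fun f : Fin N → Fin N → ℝ => f ℓ k)
      (ψ := fun f : Fin N → EuclideanSpace ℝ (Fin M) => ‖wo - f ℓ‖ ^ 2) (by fun_prop) (by fun_prop)
  have hprod : ∀ ℓ, Integrable (fun ω => net.comb i ω ℓ k * Y ℓ ω) P := fun ℓ =>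
    (hind ℓ).integrable_mul (haint ℓ) (hYint ℓ)
  have hbound : ∀ᵐ ω ∂P, ‖wo - net.iter (i + 1) ω k‖ ^ 2 ≤ ∑ ℓ, net.comb i ω ℓ k * Y ℓ ω := by
    filter_upwards [h.leftStochastic i] with ω hω
    have h1 : wo - net.iter (i + 1) ω k =
        ∑ ℓ, net.comb i ω ℓ k • (wo - net.adapt i ω (net.iter i ω) ℓ) := by
      simp only [smul_sub, Finset.sum_sub_distrib, ← Finset.sum_smul, hω.2 k, one_smul, iter]
    rw [h1]
    exact norm_sum_smul_sq_le (fun ℓ => hω.1 ℓ k) (hω.2 k) _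
  have hsum := integrable_finsetSum Finset.univ fun ℓ _ => hprod ℓ
  have hmeas : AEStronglyMeasurable (fun ω => wo - net.iter (i + 1) ω k) P :=
    (((measurable_pi_apply k).comp (h.measurable_iter (i + 1))).const_sub wo).aestronglyMeasurable
  have hsq : Integrable (fun ω => ‖wo - net.iter (i + 1) ω k‖ ^ 2) P := by
    refine hsum.mono' (hmeas.norm.pow 2) ?_
    filter_upwards [hbound] with ω hω
    rwa [Real.norm_of_nonneg (by positivity)]
  refine ⟨(memLp_two_iff_integrable_sq_norm hmeas).2 hsq, ?_⟩
  refine (integral_mono_ae hsq hsum hbound).trans ?_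
  rw [integral_finsetSum _ fun ℓ _ => hprod ℓ]
  calc ∑ ℓ, ∫ ω, net.comb i ω ℓ k * Y ℓ ω ∂P
      = ∑ ℓ, (∫ ω, net.comb i ω ℓ k ∂P) * ∫ ω, Y ℓ ω ∂P := Finset.sum_congr rfl fun ℓ _ =>
        (hind ℓ).integral_fun_mul_eq_mul_integral (haint ℓ).1 (hYint ℓ).1
    _ ≤ ∑ ℓ, (∫ ω, net.comb i ω ℓ k ∂P) * C := by
        refine Finset.sum_le_sum fun ℓ _ => mul_le_mul_of_nonneg_left (hC ℓ) ?_
        refine integral_nonneg_of_ae ?_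
        filter_upwards [h.leftStochastic i] with ω hω using hω.1 ℓ k
    _ = (∫ ω, ∑ ℓ, net.comb i ω ℓ k ∂P) * C := by
        rw [integral_finsetSum _ fun ℓ _ => haint ℓ, Finset.sum_mul]
    _ = C := by
        have : (fun ω => ∑ ℓ, net.comb i ω ℓ k) =ᵐ[P] fun _ => 1 := by
          filter_upwards [h.leftStochastic i] with ω hω using hω.2 k
        rw [integral_congr_ae this]
        simp

/-- The mean-square errors approach the steady-state level geometrically. -/
theorem Conditions.error_bound (h : net.Conditions P)
    (hn : net.GradientNoiseConditions P J wo β σs) {ν L B S ρ : ℝ}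
    (hJ : ∀ k, TwiceDifferentiable (J k))
    (hgrad : ∀ k w, inner ℝ (wo - w) (gradient (J k) w) ≤ -(ν * ‖wo - w‖ ^ 2) ∧
      ‖gradient (J k) w‖ ^ 2 ≤ L ^ 2 * ‖wo - w‖ ^ 2)
    (hβ : ∀ k, β k ^ 2 ≤ B) (hσ : ∀ k, σs k ^ 2 ≤ S) (hν : 0 < ν) (hS : 0 ≤ S)
    (hμ : net.muxMax P * (L ^ 2 + B) ≤ ν) (hμ' : ν * net.muxMax P ≤ 1)
    (hρ0 : 0 ≤ ρ) (hρ : ∀ k, 1 - ν * net.stepMean P k ≤ ρ) (i : ℕ) (k : Fin N) :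
    MemLp (fun ω => wo - net.iter i ω k) 2 P ∧
    ∫ ω, ‖wo - net.iter i ω k‖ ^ 2 ∂P ≤
      S / ν * net.muxMax P + ρ ^ i * ∑ ℓ, ∫ ω, ‖wo - net.iter 0 ω ℓ‖ ^ 2 ∂P := by
  have hE0 : ∀ ℓ, 0 ≤ ∫ ω, ‖wo - net.iter 0 ω ℓ‖ ^ 2 ∂P := fun ℓ =>
    integral_nonneg fun ω => by positivity
  set E := ∑ ℓ, ∫ ω, ‖wo - net.iter 0 ω ℓ‖ ^ 2 ∂P with hE
  have hE1 : 0 ≤ E := Finset.sum_nonneg fun ℓ _ => hE0 ℓ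
  induction i generalizing k with
  | zero =>
    refine ⟨h.memLp_error_zero k, ?_⟩
    have h1 : ∫ ω, ‖wo - net.iter 0 ω k‖ ^ 2 ∂P ≤ E :=
      Finset.single_le_sum (f := fun ℓ => ∫ ω, ‖wo - net.iter 0 ω ℓ‖ ^ 2 ∂P)
        (fun ℓ _ => hE0 ℓ) (Finset.mem_univ k)
    have h2 : 0 ≤ S / ν * net.muxMax P :=
      mul_nonneg (by positivity) ((h.stepMean_pos k).le.trans (h.stepMean_le_muxMax k))
    linarith
  | succ i ih =>
    have hψ := fun ℓ => h.adapt_error_bound hn hJ hgrad hβ hσ hμ i ℓ (ih ℓ).1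
    refine h.combine_error_bound i (fun ℓ => (hψ ℓ).1) (fun ℓ => (hψ ℓ).2.trans ?_) k
    -- Nonnegativity of the contraction factor lets the induction bound be inserted into the
    -- recursion.
    have h1 : 0 ≤ 1 - ν * net.stepMean P ℓ := by
      have := mul_le_mul_of_nonneg_left (h.stepMean_le_muxMax ℓ) hν.le
      linarith
    have h2 := mul_le_mul_of_nonneg_left (ih ℓ).2 h1
    have h3 := mul_le_mul_of_nonneg_right (hρ ℓ) (mul_nonneg (pow_nonneg hρ0 i) hE1)
    -- The noise term is `ν * stepMean` times the level `S / ν * muxMax`, so it restores exactly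
    -- what contraction removes from that level.
    have h4 : net.stepMean P ℓ * (net.muxMax P * S) =
        ν * net.stepMean P ℓ * (S / ν * net.muxMax P) := by
      field_simp
    rw [h4, pow_succ]
    linarith

end AsyncDiffusion

-- Choice of constants and passage to the limit

open AsyncDiffusion in
theorem lemma4 {N M : ℕ} (J : Fin N → EuclideanSpace ℝ (Fin M) → ℝ)
    (wo : EuclideanSpace ℝ (Fin M)) (hJ : CostConditions J wo) (β σs : Fin N → ℝ) :
    ∃ μo : ℝ, 0 < μo ∧ ∃ b : ℝ, 0 ≤ b ∧
      ∀ (Ω : Type*) [MeasurableSpace Ω] (P : Measure Ω) [IsProbabilityMeasure P]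
        (X : Type*) [MeasurableSpace X] (net : AsyncDiffusion N M Ω X),
        net.Conditions P → net.GradientNoiseConditions P J wo β σs →
        net.muxMax P < μo →
        ∀ k, limsup (net.meanSquareError P wo k) atTop ≤ ENNReal.ofReal (b * net.muxMax P) := by
  obtain ⟨ν, L, hν, hL, hgrad⟩ := hJ.exists_uniform_bounds
  set B := ∑ k, β k ^ 2 with hB
  set S := ∑ k, σs k ^ 2 with hS
  have hB0 : 0 ≤ B := Finset.sum_nonneg fun k _ => sq_nonneg _
  have hS0 : 0 ≤ S := Finset.sum_nonneg fun k _ => sq_nonneg _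
  have hβ : ∀ k, β k ^ 2 ≤ B := fun k =>
    Finset.single_le_sum (f := fun k => β k ^ 2) (fun k _ => sq_nonneg _) (Finset.mem_univ k)
  have hσ : ∀ k, σs k ^ 2 ≤ S := fun k =>
    Finset.single_le_sum (f := fun k => σs k ^ 2) (fun k _ => sq_nonneg _) (Finset.mem_univ k)
  -- A single threshold secures both `muxMax * (L ^ 2 + B) ≤ ν` and `ν * muxMax ≤ 1`.
  refine ⟨ν / (L ^ 2 + B + ν ^ 2), by positivity, S / ν, by positivity, ?_⟩
  intro Ω _ P _ X _ net h hn hlt k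
  rw [lt_div_iff₀ (by positivity)] at hlt
  have hx0 : 0 < net.muxMax P := (h.stepMean_pos k).trans_le (h.stepMean_le_muxMax k)
  have hμ : net.muxMax P * (L ^ 2 + B) ≤ ν := by
    have : 0 ≤ net.muxMax P * ν ^ 2 := by positivity
    linarith
  have hμ' : ν * net.muxMax P ≤ 1 := by
    have : 0 ≤ net.muxMax P * (L ^ 2 + B) := by positivity
    have : ν * (ν * net.muxMax P) ≤ ν * 1 := by linarith
    exact le_of_mul_le_mul_left this hν
  have : Nonempty (Fin N) := ⟨k⟩
  -- The agent with the smallest mean step-size dictates the common rate; the rate depends on the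
  -- network, but the limiting level does so only through `muxMax`.
  obtain ⟨k₀, hk₀⟩ := Finite.exists_min (net.stepMean P)
  have hm := h.stepMean_pos k₀
  have hρ0 : 0 ≤ 1 - ν * net.stepMean P k₀ := by
    have := mul_le_mul_of_nonneg_left (h.stepMean_le_muxMax k₀) hν.le
    linarith
  have hρ1 : 1 - ν * net.stepMean P k₀ < 1 := by
    have := mul_pos hν hm
    linarith
  have hbound := fun i => h.error_bound hn hJ.twiceDifferentiable hgrad hβ hσ hν hS0 hμ hμ' hρ0
    (fun j => sub_le_sub_left (mul_le_mul_of_nonneg_left (hk₀ j) hν.le) 1) i k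
  have hlim := ENNReal.tendsto_ofReal
    (((tendsto_pow_atTop_nhds_zero_of_lt_one hρ0 hρ1).mul_const
      (∑ ℓ, ∫ ω, ‖wo - net.iter 0 ω ℓ‖ ^ 2 ∂P)).const_add (S / ν * net.muxMax P))
  rw [zero_mul, add_zero] at hlim
  rw [← hlim.limsup_eq]
  refine limsup_le_limsup (Eventually.of_forall fun i => ?_)
  rw [meanSquareError_eq_ofReal (hbound i).1]
  exact ENNReal.ofReal_le_ofReal (hbound i).2
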